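/- Write $\mathcal{P}_{fin}(\mathbb{N})$ for the set of finite subsets of $\mathbb{N}$, identified with $\mathbb{N}$ by a computable bijection. For $\mathcal{S}\subseteq\mathcal{P}_{fin}(\mathbb{N})$ let $NU(\mathcal{S})$ be the set of all non-empty unions of finitely many elements of $\mathcal{S}$. Say that $\mathcal{S}$ *generates an IP set* if it contains infinitely many pairwise disjoint elements, and that $\mathcal{S}$ is an *IP set* if moreover $S\cup T\in\mathcal{S}$ for all $S,T\in\mathcal{S}$. For a coloring $c$ of $\mathcal{P}_{fin}(\mathbb{N})$, a family $\mathcal{D}$ *half-matches* a family $\mathcal{B}$ if for every $B\in\mathcal{B}$ there is $D\in\mathcal{D}$ with $c(B)=c(D\cup B)$. **Theorem.** For every $k\in\mathbb{N}$ there is a computable coloring $c:\mathcal{P}_{fin}(\mathbb{N})\to\{0,1\}$ such that: 1. for every set $\mathcal{A}$ of at most $k$ non-empty finite subsets of $\mathbb{N}$ and every computably enumerable $\mathcal{S}\subseteq\mathcal{P}_{fin}(\mathbb{N})$ that generates an IP set, $\mathcal{A}$ does not half-match $NU(\mathcal{S})$; 2. consequently, for every IP set $\mathcal{S}$ with $\emptyset\notin\mathcal{S}$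 and every $\mathcal{B}\subseteq\mathcal{S}$ with $|\mathcal{B}|\le k$, there is no computably enumerable IP set $\mathcal{T}\subseteq\{T\in\mathcal{S}\mid T\cap B=\emptyset\text{ for all }B\in\mathcal{B}\}$ that is half-matched by $\mathcal{B}$. -/

import Mathlib

/-- `NU(𝒮)`: the non-empty sets that are a union of finitely many elements of `𝒮`. -/
def nonemptyUnions (𝒮 : Set (Finset ℕ)) : Set (Finset ℕ) :=
  {T | T.Nonempty ∧ ∃ F : Finset (Finset ℕ), (∀ B ∈ F, B ∈ 𝒮) ∧ T = F.sup id}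

/-- `𝒮` generates an IP set: it contains infinitely many pairwise disjoint elements. -/
def GeneratesIP (𝒮 : Set (Finset ℕ)) : Prop :=
  ∃ 𝒟 ⊆ 𝒮, 𝒟.Infinite ∧ 𝒟.PairwiseDisjoint id

/-- `𝒮` is an IP set: it is closed under (binary, hence non-empty finite) unions and contains
an infinite set of pairwise disjoint elements. -/
def IsIP (𝒮 : Set (Finset ℕ)) : Prop :=
  (∀ S ∈ 𝒮, ∀ T ∈ 𝒮, S ∪ T ∈ 𝒮) ∧ GeneratesIP 𝒮

/-- `𝒮 - ℬ`: the elements of `𝒮` that are disjoint from every element of `ℬ`. -/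
def strongDiff (𝒮 ℬ : Set (Finset ℕ)) : Set (Finset ℕ) :=
  {T | T ∈ 𝒮 ∧ ∀ B ∈ ℬ, Disjoint T B}

/-- For the coloring `c`, the family `𝒟` half-matches the family `ℬ`: every `B ∈ ℬ` has
some `D ∈ 𝒟` with `c B = c (D ∪ B)`. -/
def HalfMatches {κ : Type*} (c : Finset ℕ → κ) (𝒟 ℬ : Set (Finset ℕ)) : Prop :=
  ∀ B ∈ ℬ, ∃ D ∈ 𝒟, c B = c (D ∪ B)

/-- A family of finite sets is computably enumerable, with finite sets of naturals coded by
Mathlib's computable bijection between `Finset ℕ` and `ℕ`. -/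
def IsCE (𝒮 : Set (Finset ℕ)) : Prop :=
  REPred fun B : Finset ℕ => B ∈ 𝒮

/-!
Finite sets are read as binary numbers, so that the union with a disjoint set is addition. Let
`A₁, …, A_k` be the sets of `𝒜` and let `B` run through the elements of a c.e. `𝒮` above all of
them. The codes of `B, A₁ ∪ B, …, A_k ∪ B` form a block, and a program `e` lists such blocks. If
`C ∈ 𝒮` lies above the first `K * (e + 1)` blocks, then adding `C` to their sets translates the
codes of the blocks by a multiple of a power `2 ^ w`, and it suffices that in one of the translated
blocks the first point gets a color different from all the others: then `B ∪ C` is the element of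
`NU(𝒮)` that is not half-matched.

The color of a set is decided at the stage given by its largest element. At stage `s`, only the
programs `e < s` and their values after `s` steps of computation are considered, and for each of
them all translates of its blocks by `2 ^ w * q`, `q < 2 ^ (s + 1)`, are served. This is a finite task, so
a table of colors that fulfills it can be found by search (`exists_computable_isGoodTable`), provided
one exists. The set `C` only has to be so large that its stage knows the first blocks of the program;
which translate `C` will produce need not be known, since all are served
(`exists_forall_stageColoring_ne`).

A table exists by a local lemma (`exists_goodColoring`). Two translates belonging to the same
program are disjoint, so each point lies in at most one translate per program, and `K * (e + 1)`
blocks fail together in at most `(2 ^ (k + 1) - 2) ^ (K * (e + 1))` of the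
`2 ^ ((k + 1) * K * (e + 1))` cases. In place of the Lovász local lemma there is a counting
argument: with `β < 2` such that `2 ^ (k + 1) - 2 < β ^ (k + 1)` and `K` large, adding a point to the
domain multiplies the number of good colorings by at least `β`, because the extensions that spoil a
translate through the new point are governed by good colorings of the domain without that translate,
which by induction are fewer by a power of `β` (`pow_mul_card_goodColorings_le`). The number of
translates does not matter, only the types of the translates through one point.
-/

/-! ### Counting colorings that avoid local bad patterns -/

section Counting

variable {ι α : Type*} [DecidableEq α]

/-- The colorings of `U` (a coloring being the set of points of color `1`) that realize none of
the bad patterns `bad i` on those supports `supp i`, `i ∈ I`, which lie inside `U`. -/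
def goodColorings (I : Finset ι) (supp : ι → Finset α) (bad : ι → Finset (Finset α))
    (U : Finset α) : Finset (Finset α) :=
  open Classical in U.powerset.filter fun f => ∀ i ∈ I, supp i ⊆ U → f ∩ supp i ∉ bad i

theorem mem_goodColorings {I : Finset ι} {supp : ι → Finset α} {bad : ι → Finset (Finset α)}
    {U f : Finset α} : f ∈ goodColorings I supp bad U ↔
      f ⊆ U ∧ ∀ i ∈ I, supp i ⊆ U → f ∩ supp i ∉ bad i := by
  simp [goodColorings]

/-- Every coloring of `U` extending a good coloring of `U.erase x` is good, or shows some bad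
pattern on a support through `x` and is good off that support. -/
theorem two_mul_card_goodColorings_erase_le (I : Finset ι) (supp : ι → Finset α)
    (bad : ι → Finset (Finset α)) {U : Finset α} {x : α} (hx : x ∈ U) :
    2 * (goodColorings I supp bad (U.erase x)).card ≤ (goodColorings I supp bad U).card +
      ∑ i ∈ I with x ∈ supp i ∧ supp i ⊆ U,
        (goodColorings I supp bad (U \ supp i)).card * (bad i).card := by
  classical
  set G := goodColorings I supp bad (U.erase x) with hG
  have hxG : ∀ f ∈ G, x ∉ f := fun f hf hxf => by
    simpa using (mem_goodColorings.1 hf).1 hxf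
  have hcard : (G ∪ G.image (insert x)).card = 2 * G.card := by
    rw [Finset.card_union_of_disjoint, Finset.card_image_of_injOn, two_mul]
    · intro f hf f' hf' h
      rw [← Finset.erase_insert (hxG f hf), ← Finset.erase_insert (hxG f' hf')]
      exact congrArg (Finset.erase · x) h
    · rw [Finset.disjoint_left]
      intro f hf hf'
      obtain ⟨f', -, rfl⟩ := Finset.mem_image.1 hf'
      exact hxG _ hf (Finset.mem_insert_self _ _)
  rw [← hcard]
  have hsub : G ∪ G.image (insert x) ⊆ goodColorings I supp bad U ∪
      (I.filter fun i => x ∈ supp i ∧ supp i ⊆ U).biUnion fun i =>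
        Finset.image₂ (· ∪ ·) (goodColorings I supp bad (U \ supp i)) (bad i) := by
    intro f hf
    have hfG : f.erase x ∈ G := by
      rcases Finset.mem_union.1 hf with h | h
      · rwa [Finset.erase_eq_of_notMem (hxG f h)]
      · obtain ⟨f', hf', rfl⟩ := Finset.mem_image.1 h
        rwa [Finset.erase_insert (hxG f' hf')]
    obtain ⟨hfU, hfgood⟩ := mem_goodColorings.1 hfG
    have hfU' : f ⊆ U := by
      intro y hy
      by_cases hyx : y = x
      · exact hyx ▸ hx
      · exact Finset.mem_of_mem_erase (hfU (Finset.mem_erase.2 ⟨hyx, hy⟩))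
    rw [Finset.mem_union]
    by_cases hgood : f ∈ goodColorings I supp bad U
    · exact Or.inl hgood
    right
    have : ∃ i ∈ I, supp i ⊆ U ∧ f ∩ supp i ∈ bad i := by
      by_contra! h
      exact hgood (mem_goodColorings.2 ⟨hfU', h⟩)
    obtain ⟨i, hi, hiU, hbad⟩ := this
    have hxi : x ∈ supp i := by
      by_contra hxi
      refine hfgood i hi (fun y hy => Finset.mem_erase.2 ⟨?_, hiU hy⟩) ?_
      · rintro rfl; exact hxi hy
      · convert hbad using 1
        ext y
        simp only [Finset.mem_inter, Finset.mem_erase]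
        constructor
        · tauto
        · rintro ⟨h1, h2⟩
          exact ⟨⟨fun h => hxi (h ▸ h2), h1⟩, h2⟩
    refine Finset.mem_biUnion.2 ⟨i, Finset.mem_filter.2 ⟨hi, hxi, hiU⟩,
      Finset.mem_image₂.2 ⟨f \ supp i, mem_goodColorings.2 ⟨Finset.sdiff_subset_sdiff hfU' le_rfl,
        fun i' hi' hsupp => ?_⟩, f ∩ supp i, hbad, Finset.sdiff_union_inter f (supp i)⟩⟩
    have h := hfgood i' hi' fun y hy => Finset.mem_erase.2
      ⟨fun h => (Finset.mem_sdiff.1 (hsupp hy)).2 (h ▸ hxi), (Finset.mem_sdiff.1 (hsupp hy)).1⟩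
    convert h using 2
    ext y
    simp only [Finset.mem_inter, Finset.mem_erase, Finset.mem_sdiff]
    constructor
    · rintro ⟨⟨h1, h2⟩, h3⟩
      exact ⟨⟨fun h => h2 (h ▸ hxi), h1⟩, h3⟩
    · rintro ⟨⟨h1, h2⟩, h3⟩
      exact ⟨⟨h2, (Finset.mem_sdiff.1 (hsupp h3)).2⟩, h3⟩
  refine (Finset.card_le_card hsub).trans ((Finset.card_union_le _ _).trans ?_)
  gcongr
  refine Finset.card_biUnion_le.trans (Finset.sum_le_sum fun i _ => ?_)
  exact Finset.card_image₂_le _ _ _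

/-- If the bad patterns on supports through any given point have total weight at most `2 - β`,
then each new point multiplies the number of good colorings by at least `β`. -/
theorem pow_mul_card_goodColorings_le {I : Finset ι} {supp : ι → Finset α}
    {bad : ι → Finset (Finset α)} {β : ℝ} (hβ : 0 < β)
    (hsum : ∀ x, ∑ i ∈ I with x ∈ supp i, ((bad i).card : ℝ) / β ^ ((supp i).card - 1) ≤ 2 - β)
    (U : Finset α) : ∀ W ⊆ U, β ^ (U \ W).card * (goodColorings I supp bad W).card ≤
      ((goodColorings I supp bad U).card : ℝ) := by
  induction U using Finset.strongInduction with
  | H U ih =>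
  intro W hWU
  by_cases hUW : U ⊆ W
  · simp [Finset.Subset.antisymm hWU hUW]
  obtain ⟨x, hxU, hxW⟩ := Finset.not_subset.1 hUW
  have ihx := ih (U.erase x) (Finset.erase_ssubset hxU)
  set N : Finset α → ℝ := fun V => ((goodColorings I supp bad V).card : ℝ) with hN
  have hstep : β * N (U.erase x) ≤ N U := by
    have h := two_mul_card_goodColorings_erase_le I supp bad hxU
    have h' : 2 * N (U.erase x) ≤ N U +
        ∑ i ∈ I with x ∈ supp i ∧ supp i ⊆ U, N (U \ supp i) * ((bad i).card : ℝ) := by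
      simp only [hN]; exact_mod_cast h
    have hterm : ∀ i ∈ I.filter fun i => x ∈ supp i ∧ supp i ⊆ U, N (U \ supp i) * ((bad i).card : ℝ) ≤
        N (U.erase x) * (((bad i).card : ℝ) / β ^ ((supp i).card - 1)) := by
      intro i hi
      obtain ⟨hxi, hiU⟩ := (Finset.mem_filter.1 hi).2
      have h := ihx (U \ supp i) fun y hy => Finset.mem_erase.2
        ⟨fun h => (Finset.mem_sdiff.1 hy).2 (h ▸ hxi), (Finset.mem_sdiff.1 hy).1⟩
      have hcard : (U.erase x \ (U \ supp i)).card = (supp i).card - 1 := by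
        rw [← Finset.card_erase_of_mem hxi]
        congr 1
        ext y
        simp only [Finset.mem_sdiff, Finset.mem_erase]
        constructor
        · tauto
        · rintro ⟨h1, h2⟩
          exact ⟨⟨h1, hiU h2⟩, fun h => h.2 h2⟩
      rw [hcard] at h
      rw [mul_div_assoc', le_div_iff₀ (by positivity)]
      calc N (U \ supp i) * ((bad i).card : ℝ) * β ^ ((supp i).card - 1)
          = β ^ ((supp i).card - 1) * N (U \ supp i) * ((bad i).card : ℝ) := by ring
        _ ≤ N (U.erase x) * ((bad i).card : ℝ) := by gcongr
    have hle := (Finset.sum_le_sum hterm).trans (Finset.sum_le_sum_of_subset_of_nonneg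
      (t := I.filter (x ∈ supp ·)) (fun i hi => Finset.mem_filter.2
        ⟨(Finset.mem_filter.1 hi).1, (Finset.mem_filter.1 hi).2.1⟩) fun i _ _ => by positivity)
    rw [← Finset.mul_sum] at hle
    have := mul_le_mul_of_nonneg_left (hsum x) (Nat.cast_nonneg (α := ℝ)
      (goodColorings I supp bad (U.erase x)).card)
    change N (U.erase x) * _ ≤ N (U.erase x) * _ at this
    linarith
  have hW := ihx W fun y hy => Finset.mem_erase.2 ⟨fun h => hxW (h ▸ hy), hWU hy⟩
  have hcard : (U \ W).card = ((U.erase x) \ W).card + 1 := by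
    rw [Finset.erase_sdiff_comm, Finset.card_erase_add_one (Finset.mem_sdiff.2 ⟨hxU, hxW⟩)]
  calc β ^ (U \ W).card * N W = β * (β ^ (U.erase x \ W).card * N W) := by
        rw [hcard, pow_succ]; ring
    _ ≤ β * N (U.erase x) := by gcongr
    _ ≤ N U := hstep

/-- A form of the Lovász local lemma, proved by counting: the number of good colorings of `U` is
positive, being at least a power of `β` times the number of those of `∅`. -/
theorem exists_goodColoring {I : Finset ι} {supp : ι → Finset α}
    {bad : ι → Finset (Finset α)} {β : ℝ} (hβ : 0 < β)
    (hsum : ∀ x, ∑ i ∈ I with x ∈ supp i, ((bad i).card : ℝ) / β ^ ((supp i).card - 1) ≤ 2 - β)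
    (hne : ∀ i ∈ I, (supp i).Nonempty) (U : Finset α) :
    ∃ f, ∀ i ∈ I, supp i ⊆ U → f ∩ supp i ∉ bad i := by
  have h := pow_mul_card_goodColorings_le hβ hsum U ∅ (Finset.empty_subset U)
  have h0 : ∅ ∈ goodColorings I supp bad ∅ := mem_goodColorings.2 ⟨le_rfl, fun i hi hi0 =>
    absurd (Finset.subset_empty.1 hi0) (hne i hi).ne_empty⟩
  have h1 : 0 < (goodColorings I supp bad ∅).card := Finset.card_pos.2 ⟨_, h0⟩
  have h2 : 0 < (goodColorings I supp bad U).card := by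
    have : (0 : ℝ) < (goodColorings I supp bad U).card := lt_of_lt_of_le (by positivity) h
    exact_mod_cast this
  obtain ⟨f, hf⟩ := Finset.card_pos.1 h2
  exact ⟨f, (mem_goodColorings.1 hf).2⟩

/-! ### Coloring blocks so that a center differs from all other points -/

/-- Among the colorings of one block of `k + 1` points, only two separate the point `cell 0` from
all the others. -/
theorem card_filter_block_le (k : ℕ) (cell : ℕ → α)
    (hinj : ∀ m < k + 1, ∀ m' < k + 1, cell m = cell m' → m = m') :
    (((Finset.range (k + 1)).image cell).powerset.filter fun f =>
      ∃ j < k, (cell 0 ∈ f ↔ cell (j + 1) ∈ f)).card ≤ 2 ^ (k + 1) - 2 := by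
  classical
  set B := (Finset.range (k + 1)).image cell with hB
  have hBcard : B.card = k + 1 := by
    rw [hB, Finset.card_image_of_injOn, Finset.card_range]
    intro m hm m' hm' h
    exact hinj m (by simpa using hm) m' (by simpa using hm') h
  have h0B : cell 0 ∈ B := Finset.mem_image_of_mem _ (by simp)
  have hne : ∀ j < k, cell (j + 1) ≠ cell 0 := fun j hj h => by
    have := hinj (j + 1) (by omega) 0 (by omega) h
    omega
  have hsub : (B.powerset.filter fun f => ∃ j < k, (cell 0 ∈ f ↔ cell (j + 1) ∈ f)) ⊆
      B.powerset \ {{cell 0}, B.erase (cell 0)} := by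
    intro f hf
    obtain ⟨hfB, j, hj, hiff⟩ := Finset.mem_filter.1 hf
    refine Finset.mem_sdiff.2 ⟨hfB, fun h => ?_⟩
    rcases Finset.mem_insert.1 h with rfl | h
    · simp [hne j hj] at hiff
    · rw [Finset.mem_singleton] at h
      subst h
      have : cell (j + 1) ∈ B := Finset.mem_image_of_mem _ (by simpa using hj)
      simp [hne j hj, this] at hiff
  have hpair : ({{cell 0}, B.erase (cell 0)} : Finset (Finset α)) ⊆ B.powerset := by
    intro f hf
    rcases Finset.mem_insert.1 hf with rfl | h
    · simpa using h0B
    · rw [Finset.mem_singleton.1 h]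
      exact Finset.mem_powerset.2 (Finset.erase_subset _ _)
  have hpaircard : ({{cell 0}, B.erase (cell 0)} : Finset (Finset α)).card = 2 := by
    refine Finset.card_pair fun h => ?_
    have : cell 0 ∈ B.erase (cell 0) := h ▸ Finset.mem_singleton_self _
    simp at this
  refine (Finset.card_le_card hsub).trans ?_
  rw [Finset.card_sdiff_of_subset hpair, hpaircard, Finset.card_powerset, hBcard]

/-- Of the colorings of `M` disjoint blocks of `k + 1` points, at most `(2 ^ (k + 1) - 2) ^ M`
separate no center `cell (b * (k + 1))` from all other points of its block. -/
theorem card_filter_blocks_le (k M : ℕ) (cell : ℕ → α)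
    (hinj : ∀ m < M * (k + 1), ∀ m' < M * (k + 1), cell m = cell m' → m = m') :
    (((Finset.range (M * (k + 1))).image cell).powerset.filter fun f =>
      ∀ b < M, ∃ j < k, (cell (b * (k + 1)) ∈ f ↔ cell (b * (k + 1) + j + 1) ∈ f)).card ≤
        (2 ^ (k + 1) - 2) ^ M := by
  classical
  induction M with
  | zero => simp
  | succ M ih =>
    have hlt : ∀ {b j}, b < M → j < k + 1 → b * (k + 1) + j < M * (k + 1) := by
      intro b j hb hj
      nlinarith
    have hsucc : (M + 1) * (k + 1) = M * (k + 1) + (k + 1) := by ring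
    specialize ih fun m hm m' hm' => hinj m (by omega) m' (by omega)
    have hblock := card_filter_block_le k (fun j => cell (M * (k + 1) + j)) fun m hm m' hm' h => by
      have := hinj _ (by omega) _ (by omega) h
      omega
    rw [pow_succ]
    refine le_trans (Finset.card_le_card ?_) ((Finset.card_image₂_le (· ∪ ·) _ _).trans
      (Nat.mul_le_mul ih hblock))
    intro f hf
    obtain ⟨hfsub, hf⟩ := Finset.mem_filter.1 hf
    rw [Finset.mem_powerset] at hfsub
    refine Finset.mem_image₂.2 ⟨f ∩ (Finset.range (M * (k + 1))).image cell, ?_,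
      f ∩ (Finset.range (k + 1)).image fun j => cell (M * (k + 1) + j), ?_, ?_⟩
    · refine Finset.mem_filter.2 ⟨Finset.mem_powerset.2 Finset.inter_subset_right, fun b hb => ?_⟩
      obtain ⟨j, hj, h⟩ := hf b (by omega)
      have hmem : ∀ j < k + 1,
          cell (b * (k + 1) + j) ∈ (Finset.range (M * (k + 1))).image cell := fun j hj =>
        Finset.mem_image_of_mem _ (Finset.mem_range.2 (hlt hb hj))
      refine ⟨j, hj, ?_⟩
      have h1 := hmem 0 (by omega)
      have h2 := hmem (j + 1) (by omega)
      simp only [add_zero, ← add_assoc] at h1 h2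
      simpa [Finset.mem_inter, -Finset.mem_image, h1, h2] using h
    · refine Finset.mem_filter.2 ⟨Finset.mem_powerset.2 Finset.inter_subset_right, ?_⟩
      obtain ⟨j, hj, h⟩ := hf M (by omega)
      have hmem : ∀ j < k + 1, cell (M * (k + 1) + j) ∈
          (Finset.range (k + 1)).image fun j => cell (M * (k + 1) + j) := fun j hj =>
        Finset.mem_image_of_mem (fun j => cell (M * (k + 1) + j)) (Finset.mem_range.2 hj)
      refine ⟨j, hj, ?_⟩
      have h1 := hmem 0 (by omega)
      have h2 := hmem (j + 1) (by omega)
      simp only [add_zero, ← add_assoc] at h1 h2 ⊢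
      simpa only [Finset.mem_inter, h1, h2, and_true] using h
    · rw [← Finset.inter_union_distrib_left, Finset.inter_eq_left]
      intro y hy
      obtain ⟨m, hm, rfl⟩ := Finset.mem_image.1 (hfsub hy)
      rw [Finset.mem_range] at hm
      by_cases h : m < M * (k + 1)
      · exact Finset.mem_union_left _ (Finset.mem_image_of_mem _ (Finset.mem_range.2 h))
      · refine Finset.mem_union_right _ (Finset.mem_image.2
          ⟨m - M * (k + 1), Finset.mem_range.2 (by omega), ?_⟩)
        rw [Nat.add_sub_cancel' (by omega)]

/-- There are `β > 0` and `K > 0` for which `K * (e + 1)` blocks of `k + 1` points make a bad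
pattern of type `e` so unlikely that the total weight over all types is at most `2 - β`. -/
theorem exists_growthRate_blockFactor (k : ℕ) : ∃ (β : ℝ) (K : ℕ), 0 < β ∧ 0 < K ∧
    ∀ s, ∑ e ∈ Finset.range s, ((2 ^ (k + 1) - 2 : ℕ) : ℝ) ^ (K * (e + 1)) /
      β ^ (K * (e + 1) * (k + 1) - 1) ≤ 2 - β := by
  set p : ℝ := ((2 ^ (k + 1) - 2 : ℕ) : ℝ) with hp
  have hp2 : p < (2 : ℝ) ^ (k + 1) := by
    rw [hp]
    have : 2 ^ (k + 1) - 2 < 2 ^ (k + 1) := Nat.sub_lt (by positivity) (by norm_num)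
    exact_mod_cast this
  have hcont : ∀ᶠ β : ℝ in nhdsWithin 2 (Set.Iio 2), p < β ^ (k + 1) :=
    (((continuous_pow (k + 1)).tendsto (2 : ℝ)).eventually (lt_mem_nhds hp2)).filter_mono
      nhdsWithin_le_nhds
  have h1 : ∀ᶠ β : ℝ in nhdsWithin 2 (Set.Iio 2), 1 < β :=
    (lt_mem_nhds (by norm_num : (1 : ℝ) < 2)).filter_mono nhdsWithin_le_nhds
  -- Any `β < 2` close enough to `2` will do, and then `K` is chosen to make `ρ ^ K` small.
  obtain ⟨β, ⟨hpβ, hβ1⟩, hβ2⟩ := ((hcont.and h1).and self_mem_nhdsWithin).exists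
  have hβ2 : β < 2 := hβ2
  have hβ0 : 0 < β := by linarith
  set ρ : ℝ := p / β ^ (k + 1) with hρ
  have hρ0 : 0 ≤ ρ := div_nonneg (Nat.cast_nonneg _) (by positivity)
  have hρ1 : ρ < 1 := (div_lt_one (by positivity)).2 hpβ
  obtain ⟨K, hK⟩ := ((tendsto_pow_atTop_nhds_zero_of_lt_one hρ0 hρ1).eventually
    (gt_mem_nhds (by linarith : (0 : ℝ) < (2 - β) / 4))).and
      (Filter.eventually_gt_atTop 0) |>.exists
  refine ⟨β, K, hβ0, hK.2, fun s => ?_⟩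
  have hterm : ∀ e ∈ Finset.range s, p ^ (K * (e + 1)) / β ^ (K * (e + 1) * (k + 1) - 1) ≤
      (2 - β) / 2 * (1 / 2) ^ e := by
    intro e _
    have hpos : 0 < K * (e + 1) * (k + 1) := Nat.mul_pos (Nat.mul_pos hK.2 (by omega)) (by omega)
    have hβpow : β ^ (K * (e + 1) * (k + 1)) = β ^ (K * (e + 1) * (k + 1) - 1) * β := by
      rw [← pow_succ, Nat.sub_add_cancel hpos]
    have heq : p ^ (K * (e + 1)) / β ^ (K * (e + 1) * (k + 1) - 1) = β * ((ρ ^ K) ^ e * ρ ^ K) := by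
      rw [← pow_succ, ← pow_mul, hρ, div_pow, ← pow_mul, mul_comm (k + 1), hβpow]
      field_simp
    rw [heq]
    have hhalf : ρ ^ K ≤ 1 / 2 := by linarith [hK.1]
    have := pow_le_pow_left₀ (by positivity) hhalf e
    calc β * ((ρ ^ K) ^ e * ρ ^ K) ≤ 2 * ((1 / 2) ^ e * ((2 - β) / 4)) := by
          gcongr
          exact hK.1.le
      _ = _ := by ring
  refine (Finset.sum_le_sum hterm).trans ?_
  rw [← Finset.mul_sum]
  have hgeom : ∑ e ∈ Finset.range s, (1 / 2 : ℝ) ^ e ≤ 2 := sum_geometric_two_le s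
  nlinarith

/-- For some `K`, any finite family of events `i` of types `typ i`, an event of type `e` consisting
of `K * (e + 1)` blocks of `k + 1` distinct points and events of the same type being disjoint, has
a coloring that in each event separates some block's center from all other points of the block. -/
theorem exists_blockFactor (k : ℕ) : ∃ K : ℕ, ∀ {ι α : Type} [DecidableEq α]
    (I : Finset ι) (typ : ι → ℕ) (cell : ι → ℕ → α),
    (∀ i ∈ I, ∀ m < K * (typ i + 1) * (k + 1), ∀ m' < K * (typ i + 1) * (k + 1),
      cell i m = cell i m' → m = m') →
    (∀ i ∈ I, ∀ i' ∈ I, typ i = typ i' → ∀ m < K * (typ i + 1) * (k + 1),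
      ∀ m' < K * (typ i + 1) * (k + 1), cell i m = cell i' m' → i = i') →
    ∃ f : Finset α, ∀ i ∈ I, ∃ b < K * (typ i + 1), ∀ j < k,
      ¬ (cell i (b * (k + 1)) ∈ f ↔ cell i (b * (k + 1) + j + 1) ∈ f) := by
  obtain ⟨β, K, hβ, hK, hsum⟩ := exists_growthRate_blockFactor k
  refine ⟨K, fun {ι α} _ I typ cell hinj hdisj => ?_⟩
  classical
  set supp : ι → Finset α := fun i => (Finset.range (K * (typ i + 1) * (k + 1))).image (cell i)
    with hsupp
  set bad : ι → Finset (Finset α) := fun i => (supp i).powerset.filter fun f =>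
    ∀ b < K * (typ i + 1), ∃ j < k,
      (cell i (b * (k + 1)) ∈ f ↔ cell i (b * (k + 1) + j + 1) ∈ f) with hbad
  have hscard : ∀ i ∈ I, (supp i).card = K * (typ i + 1) * (k + 1) := fun i hi => by
    simp only [hsupp]
    rw [Finset.card_image_of_injOn, Finset.card_range]
    intro m hm m' hm' h
    exact hinj i hi m (by simpa using hm) m' (by simpa using hm') h
  have hlt : ∀ {M b j}, b < M → j < k + 1 → b * (k + 1) + j < M * (k + 1) := by
    intro M b j hb hj
    nlinarith
  have hweight : ∀ x, ∑ i ∈ I with x ∈ supp i, ((bad i).card : ℝ) / β ^ ((supp i).card - 1) ≤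
      2 - β := by
    intro x
    -- Through `x` passes at most one event of each type.
    set Ix := I.filter (x ∈ supp ·) with hIx
    set w : ℕ → ℝ := fun e => ((2 ^ (k + 1) - 2 : ℕ) : ℝ) ^ (K * (e + 1)) /
      β ^ (K * (e + 1) * (k + 1) - 1) with hw
    have hinjx : Set.InjOn typ Ix := by
      intro i hi i' hi' h
      obtain ⟨hi, hxi⟩ := Finset.mem_filter.1 hi
      obtain ⟨hi', hxi'⟩ := Finset.mem_filter.1 hi'
      obtain ⟨m, hm, hmx⟩ := Finset.mem_image.1 hxi
      obtain ⟨m', hm', hmx'⟩ := Finset.mem_image.1 hxi'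
      exact hdisj i hi i' hi' h m (Finset.mem_range.1 hm) m' (h ▸ Finset.mem_range.1 hm')
        (hmx.trans hmx'.symm)
    calc ∑ i ∈ Ix, ((bad i).card : ℝ) / β ^ ((supp i).card - 1) ≤ ∑ i ∈ Ix, w (typ i) := by
          refine Finset.sum_le_sum fun i hi => ?_
          have hi := (Finset.mem_filter.1 hi).1
          have hb := card_filter_blocks_le k (K * (typ i + 1)) (cell i) (hinj i hi)
          rw [hscard i hi]
          simp only [hw]
          gcongr
          exact_mod_cast hb
      _ = ∑ e ∈ Ix.image typ, w e := (Finset.sum_image hinjx).symm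
      _ ≤ ∑ e ∈ Finset.range ((Ix.image typ).sup id + 1), w e := by
          refine Finset.sum_le_sum_of_subset_of_nonneg (fun e he => ?_) fun e _ _ => by positivity
          exact Finset.mem_range.2 (Nat.lt_succ_of_le (Finset.le_sup (f := id) he))
      _ ≤ 2 - β := hsum _
  obtain ⟨f, hf⟩ := exists_goodColoring hβ hweight
    (fun i _ => ⟨cell i 0, Finset.mem_image_of_mem _ (Finset.mem_range.2
      (Nat.mul_pos (Nat.mul_pos hK (by omega)) (by omega)))⟩) (I.biUnion supp)
  refine ⟨f, fun i hi => ?_⟩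
  have h := hf i hi (Finset.subset_biUnion_of_mem supp hi)
  by_contra! hcon
  refine h (Finset.mem_filter.2 ⟨Finset.mem_powerset.2 Finset.inter_subset_right, fun b hb => ?_⟩)
  obtain ⟨j, hj, hiff⟩ := hcon b hb
  have hmem : ∀ j < k + 1, cell i (b * (k + 1) + j) ∈ supp i := fun j hj =>
    Finset.mem_image_of_mem _ (Finset.mem_range.2 (hlt hb hj))
  have h1 := hmem 0 (by omega)
  have h2 := hmem (j + 1) (by omega)
  simp only [add_zero, ← add_assoc] at h1 h2
  exact ⟨j, hj, by simpa only [Finset.mem_inter, h1, h2, and_true] using hiff⟩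

end Counting

/-! ### Computability of the binary code -/

/-- The natural number whose binary digits are given by the finite set `F`. -/
def binaryCode (F : Finset ℕ) : ℕ := ∑ i ∈ F, 2 ^ i

theorem primrec_two_pow : Primrec fun n : ℕ => 2 ^ n :=
  (Primrec.nat_rec₁ 1 (Primrec.nat_double.comp Primrec.snd).to₂).of_eq fun n => by
    induction n with
    | zero => rfl
    | succ n ih => rw [pow_succ, ← ih, mul_comm]

/-- The sum of the powers `2 ^ i` over a list `raise' l n` as a fold over `l`; Mathlib's bijection
between `ℕ` and `Finset ℕ` goes through such lists. -/
theorem sum_two_pow_raise' (l : List ℕ) : ∀ p : ℕ × ℕ,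
    (l.foldl (fun (p : ℕ × ℕ) m => (p.1 + 2 ^ (m + p.2), m + p.2 + 1)) p).1 =
      p.1 + ((Denumerable.raise' l p.2).map (2 ^ ·)).sum := by
  induction l with
  | nil => intro p; simp [Denumerable.raise']
  | cons m l ih =>
    intro p
    rw [List.foldl_cons, ih]
    simp [Denumerable.raise', add_assoc]

theorem binaryCode_ofNat (n : ℕ) : binaryCode (Denumerable.ofNat (Finset ℕ) n) =
    ((Denumerable.raise' (Denumerable.ofNat (List ℕ) n) 0).map (2 ^ ·)).sum := by
  have : Denumerable.ofNat (Finset ℕ) n =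
      Denumerable.raise'Finset (Denumerable.ofNat (List ℕ) n) 0 := by
    change Finset.map (Denumerable.eqv ℕ).symm.toEmbedding _ = _
    ext x
    simp [Denumerable.eqv]
  rw [this]
  rfl

theorem primrec_binaryCode : Primrec binaryCode := by
  refine Primrec.ofNat_iff.2 ?_
  have hl : Primrec (Denumerable.ofNat (List ℕ)) := Primrec.ofNat (List ℕ)
  have hstep : Primrec₂ fun (_ : ℕ) (q : (ℕ × ℕ) × ℕ) =>
      (q.1.1 + 2 ^ (q.2 + q.1.2), q.2 + q.1.2 + 1) := by
    have hs : Primrec fun q : ℕ × ((ℕ × ℕ) × ℕ) => q.2.2 + q.2.1.2 :=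
      Primrec.nat_add.comp (Primrec.snd.comp Primrec.snd)
        (Primrec.snd.comp (Primrec.fst.comp Primrec.snd))
    exact (Primrec.pair (Primrec.nat_add.comp (Primrec.fst.comp (Primrec.fst.comp Primrec.snd))
      (primrec_two_pow.comp hs)) (Primrec.succ.comp hs)).to₂
  refine (Primrec.fst.comp (Primrec.list_foldl hl (Primrec.const ((0, 0) : ℕ × ℕ)) hstep)).of_eq
    fun n => ?_
  rw [sum_two_pow_raise', binaryCode_ofNat, zero_add]

theorem binaryCode_injective : Function.Injective binaryCode :=
  Finset.geomSum_injective le_rfl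

theorem binaryCode_union {F G : Finset ℕ} (h : Disjoint F G) :
    binaryCode (F ∪ G) = binaryCode F + binaryCode G :=
  Finset.sum_union h

theorem binaryCode_lt_two_pow {F : Finset ℕ} {b : ℕ} (h : ∀ x ∈ F, x < b) : binaryCode F < 2 ^ b :=
  Nat.geomSum_lt le_rfl h

theorem lt_of_binaryCode_lt {F : Finset ℕ} {b x : ℕ} (h : binaryCode F < 2 ^ b) (hx : x ∈ F) :
    x < b := by
  refine (Nat.pow_lt_pow_iff_right (a := 2) (by norm_num)).1 (lt_of_le_of_lt ?_ h)
  exact Finset.single_le_sum (f := fun i => 2 ^ i) (fun _ _ => Nat.zero_le _) hx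

theorem two_pow_dvd_binaryCode_iff {F : Finset ℕ} {b : ℕ} :
    2 ^ b ∣ binaryCode F ↔ ∀ x ∈ F, b ≤ x := by
  have hup : ∀ G : Finset ℕ, (∀ x ∈ G, b ≤ x) → 2 ^ b ∣ binaryCode G := fun G h =>
    Finset.dvd_sum fun i hi => pow_dvd_pow 2 (h i hi)
  refine ⟨fun h x hx => ?_, hup F⟩
  by_contra! hxb
  have hsplit : binaryCode (F.filter (· < b)) + binaryCode (F.filter (¬ · < b)) = binaryCode F :=
    Finset.sum_filter_add_sum_filter_not F (· < b) _
  have hdvd : 2 ^ b ∣ binaryCode (F.filter (· < b)) := by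
    refine (Nat.dvd_add_iff_left (hup (F.filter (¬ · < b)) fun x hx => ?_)).2 (hsplit ▸ h)
    exact not_lt.1 (Finset.mem_filter.1 hx).2
  have hzero := Nat.eq_zero_of_dvd_of_lt hdvd
    (binaryCode_lt_two_pow fun x hx => (Finset.mem_filter.1 hx).2)
  have := (Finset.sum_eq_zero_iff.1 hzero) x (Finset.mem_filter.2 ⟨hx, hxb⟩)
  exact absurd this (by positivity)

/-! ### Enumerating an infinite computably enumerable set -/

/-- An infinite c.e. set contains the range of a computable sequence along which a given computable
injective size function increases. -/
theorem REPred.exists_computable_strictMono {α : Type*} [Primcodable α] {p : α → Prop}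
    (hp : REPred p) (hinf : {a | p a}.Infinite) {size : α → ℕ} (hsize : Computable size)
    (hinj : Function.Injective size) :
    ∃ h : ℕ → α, Computable h ∧ (∀ n, p (h n)) ∧ StrictMono (size ∘ h) := by
  obtain ⟨c, hc⟩ := Nat.Partrec.Code.exists_code.1 hp
  have hmem : ∀ a, p a ↔ ∃ t, (Nat.Partrec.Code.evaln t c (Encodable.encode a)).isSome := by
    intro a
    have h1 : (Nat.Partrec.Code.eval c (Encodable.encode a)).Dom ↔ p a := by
      rw [hc]; simp [Part.assert]
    rw [← h1, Part.dom_iff_mem]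
    simp only [Nat.Partrec.Code.evaln_complete, Option.isSome_iff_exists]
    exact exists_comm
  obtain ⟨a₀, ha₀⟩ := hinf.nonempty
  -- The search runs over pairs of a code of an element and a number of steps.
  set elt : ℕ → α := fun n => (Encodable.decode n.unpair.1).getD a₀ with helt
  have helt_pr : Primrec elt :=
    Primrec.option_getD.comp (Primrec.decode.comp (Primrec.fst.comp Primrec.unpair))
      (Primrec.const a₀)
  set P : α → ℕ → Prop := fun a n => size a < size (elt n) ∧
    (Nat.Partrec.Code.evaln n.unpair.2 c (Encodable.encode (elt n))).isSome with hP
  have hPc : ComputablePred fun q : α × ℕ => P q.1 q.2 := by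
    have h1 : Computable fun q : α × ℕ => decide (size q.1 < size (elt q.2)) :=
      Primrec.nat_lt.decide.to_comp.comp (hsize.comp Computable.fst)
        (hsize.comp (helt_pr.to_comp.comp Computable.snd))
    have h2 : Primrec fun q : α × ℕ =>
        (Nat.Partrec.Code.evaln q.2.unpair.2 c (Encodable.encode (elt q.2))).isSome :=
      Primrec.option_isSome.comp (Nat.Partrec.Code.primrec_evaln.comp
        (((Primrec.snd.comp (Primrec.unpair.comp Primrec.snd)).pair (Primrec.const c)).pair
          (Primrec.encode.comp (helt_pr.comp Primrec.snd))))
    refine Computable.computablePred (p := fun q : α × ℕ => P q.1 q.2)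
      ((Primrec.and.to_comp.comp h1 h2.to_comp).of_eq fun q => ?_)
    simp [hP]
  have hPex : ∀ a, ∃ n, P a n := by
    intro a
    have : (size '' {a | p a}).Infinite := hinf.image hinj.injOn
    obtain ⟨_, ⟨b, hb, rfl⟩, hab⟩ := this.exists_gt (size a)
    obtain ⟨t, ht⟩ := (hmem b).1 hb
    exact ⟨Nat.pair (Encodable.encode b) t, by simp [hP, helt, hab, ht]⟩
  set next : α → α := fun a => elt (Nat.find (hPex a)) with hnext
  have hnext_comp : Computable next := helt_pr.to_comp.comp (Computable.find hPc hPex)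
  have hnext_spec : ∀ a, size a < size (next a) ∧ p (next a) := fun a =>
    ⟨(Nat.find_spec (hPex a)).1, (hmem _).2 ⟨_, (Nat.find_spec (hPex a)).2⟩⟩
  set h : ℕ → α := fun n => Nat.rec a₀ (fun _ a => next a) n with hh
  have hmono : StrictMono (size ∘ h) :=
    strictMono_nat_of_lt_succ fun n => (hnext_spec (h n)).1
  refine ⟨h, ?_, fun n => ?_, hmono⟩
  · exact Computable.nat_rec Computable.id (Computable.const a₀)
      (hnext_comp.comp (Computable.snd.comp Computable.snd)).to₂
  · cases n with
    | zero => exact ha₀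
    | succ n => exact (hnext_spec (h n)).2

/-! ### Tables of colors -/

theorem PrimrecPred.forall_lt_of {α : Type*} [Primcodable α] {p : α → ℕ → Prop} {f : α → ℕ}
    (hf : Primrec f) (hp : PrimrecPred fun q : α × ℕ => p q.1 q.2) :
    PrimrecPred fun a => ∀ x < f a, p a x := by
  have hR : PrimrecRel fun (x : ℕ) (a : α) => p a x :=
    hp.comp (Primrec.snd.pair Primrec.fst)
  exact (hR.forall_mem_list.comp (Primrec.list_range.comp hf) Primrec.id).of_eq fun a => by simp

theorem PrimrecPred.exists_lt_of {α : Type*} [Primcodable α] {p : α → ℕ → Prop} {f : α → ℕ}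
    (hf : Primrec f) (hp : PrimrecPred fun q : α × ℕ => p q.1 q.2) :
    PrimrecPred fun a => ∃ x < f a, p a x := by
  have hR : PrimrecRel fun (x : ℕ) (a : α) => p a x :=
    hp.comp (Primrec.snd.pair Primrec.fst)
  exact (hR.exists_mem_list.comp (Primrec.list_range.comp hf) Primrec.id).of_eq fun a => by simp

theorem PrimrecPred.imp {α : Type*} [Primcodable α] {p q : α → Prop}
    (hp : PrimrecPred p) (hq : PrimrecPred q) : PrimrecPred fun a => p a → q a :=
  (hp.not.or hq).of_eq fun _ => imp_iff_not_or.symm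

/-- The value at `i` of the `e`-th program, as known after `s` steps; `0` if it is not yet known. -/
def approx (s e i : ℕ) : ℕ :=
  (Nat.Partrec.Code.evaln s (Denumerable.ofNat Nat.Partrec.Code e) i).getD 0

/-- An exponent `w` with `2 ^ w` above the first `n` approximate values of the `e`-th program. -/
def approxWidth (s e n : ℕ) : ℕ := ∑ i ∈ Finset.range n, approx s e i

/-- The color of `x` in the table, a list of colors, with code `t`. -/
def tableColor (t x : ℕ) : Bool :=
  ((Encodable.decode t : Option (List Bool)).getD []).getD x false

/-- The color, in the table with code `t`, of the `m`-th approximate value of the `e`-th program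
after translation by the `q`-th multiple of a power of two above its first `n` values. -/
def translateColor (s e n t q m : ℕ) : Bool :=
  tableColor t (2 ^ approxWidth s e n * q + approx s e m)

/-- The table with code `t` is good for stage `s`: for every program `e < s` whose first
`K * (e + 1) * (k + 1)` approximate values are distinct, those values form `K * (e + 1)` blocks of
length `k + 1`, and each translate of these blocks contains a block whose first point gets a color
different from that of all other points of the block. -/
def IsGoodTable (K k s t : ℕ) : Prop :=
  ∀ e < s, (∀ m < K * (e + 1) * (k + 1), ∀ m' < m, approx s e m ≠ approx s e m') →
    ∀ q < 2 ^ (s + 1), ∃ b < K * (e + 1), ∀ j < k,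
      translateColor s e (K * (e + 1) * (k + 1)) t q (b * (k + 1)) ≠
        translateColor s e (K * (e + 1) * (k + 1)) t q (b * (k + 1) + j + 1)

theorem primrec_approx : Primrec fun a : ℕ × ℕ × ℕ => approx a.1 a.2.1 a.2.2 :=
  Primrec.option_getD.comp (Nat.Partrec.Code.primrec_evaln.comp
    ((Primrec.fst.pair ((Primrec.ofNat Nat.Partrec.Code).comp (Primrec.fst.comp Primrec.snd))).pair
      (Primrec.snd.comp Primrec.snd))) (Primrec.const 0)

theorem primrec_approxWidth : Primrec fun a : ℕ × ℕ × ℕ => approxWidth a.1 a.2.1 a.2.2 := by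
  have hstep : Primrec₂ fun (a : ℕ × ℕ × ℕ) (r : ℕ × ℕ) => r.2 + approx a.1 a.2.1 r.1 :=
    Primrec.nat_add.comp (Primrec.snd.comp Primrec.snd) (primrec_approx.comp
      ((Primrec.fst.comp Primrec.fst).pair
        ((Primrec.fst.comp (Primrec.snd.comp Primrec.fst)).pair (Primrec.fst.comp Primrec.snd))))
  refine (Primrec.nat_rec' (Primrec.snd.comp Primrec.snd) (Primrec.const 0) hstep).of_eq ?_
  rintro ⟨s, e, n⟩
  induction n with
  | zero => rfl
  | succ n ih => rw [approxWidth, Finset.sum_range_succ, ← approxWidth]; exact congrArg (· + _) ih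

theorem primrec_tableColor : Primrec₂ tableColor :=
  (Primrec.list_getD false).comp (Primrec.option_getD.comp (Primrec.decode.comp Primrec.fst)
    (Primrec.const [])) Primrec.snd

theorem primrec_translateColor : Primrec fun a : (ℕ × ℕ × ℕ) × ℕ × ℕ × ℕ =>
    translateColor a.1.1 a.1.2.1 a.1.2.2 a.2.1 a.2.2.1 a.2.2.2 := by
  have h1 : Primrec fun a : (ℕ × ℕ × ℕ) × ℕ × ℕ × ℕ =>
      2 ^ approxWidth a.1.1 a.1.2.1 a.1.2.2 * a.2.2.1 :=
    Primrec.nat_mul.comp (primrec_two_pow.comp (primrec_approxWidth.comp Primrec.fst))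
      (Primrec.fst.comp (Primrec.snd.comp Primrec.snd))
  have h2 : Primrec fun a : (ℕ × ℕ × ℕ) × ℕ × ℕ × ℕ => approx a.1.1 a.1.2.1 a.2.2.2 :=
    primrec_approx.comp ((Primrec.fst.comp Primrec.fst).pair
      ((Primrec.fst.comp (Primrec.snd.comp Primrec.fst)).pair
        (Primrec.snd.comp (Primrec.snd.comp Primrec.snd))))
  exact primrec_tableColor.comp (Primrec.fst.comp Primrec.snd) (Primrec.nat_add.comp h1 h2)

theorem primrecPred_isGoodTable (K k : ℕ) :
    PrimrecPred fun a : ℕ × ℕ => IsGoodTable K k a.1 a.2 := by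
  have hblocks : Primrec fun e : ℕ => K * (e + 1) :=
    Primrec.nat_mul.comp (Primrec.const K) Primrec.succ
  have hcells : Primrec fun e : ℕ => K * (e + 1) * (k + 1) :=
    Primrec.nat_mul.comp hblocks (Primrec.const (k + 1))
  have hdistinct : PrimrecPred fun a : (ℕ × ℕ) × ℕ =>
      ∀ m < K * (a.2 + 1) * (k + 1), ∀ m' < m, approx a.1.1 a.2 m ≠ approx a.1.1 a.2 m' := by
    have h1 : Primrec fun a : (((ℕ × ℕ) × ℕ) × ℕ) × ℕ => approx a.1.1.1.1 a.1.1.2 a.1.2 :=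
      primrec_approx.comp ((Primrec.fst.comp (Primrec.fst.comp (Primrec.fst.comp
        Primrec.fst))).pair ((Primrec.snd.comp (Primrec.fst.comp Primrec.fst)).pair
          (Primrec.snd.comp Primrec.fst)))
    have h2 : Primrec fun a : (((ℕ × ℕ) × ℕ) × ℕ) × ℕ => approx a.1.1.1.1 a.1.1.2 a.2 :=
      primrec_approx.comp ((Primrec.fst.comp (Primrec.fst.comp (Primrec.fst.comp
        Primrec.fst))).pair ((Primrec.snd.comp (Primrec.fst.comp Primrec.fst)).pair Primrec.snd))
    exact PrimrecPred.forall_lt_of (hcells.comp Primrec.snd)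
      (PrimrecPred.forall_lt_of Primrec.snd (PrimrecPred.not (Primrec.eq.comp h1 h2)))
  have hblock : PrimrecPred fun a : (((ℕ × ℕ) × ℕ) × ℕ) × ℕ => ∀ j < k,
      translateColor a.1.1.1.1 a.1.1.2 (K * (a.1.1.2 + 1) * (k + 1)) a.1.1.1.2 a.1.2
          (a.2 * (k + 1)) ≠
        translateColor a.1.1.1.1 a.1.1.2 (K * (a.1.1.2 + 1) * (k + 1)) a.1.1.1.2 a.1.2
          (a.2 * (k + 1) + j + 1) := by
    have hctx : Primrec fun a : ((((ℕ × ℕ) × ℕ) × ℕ) × ℕ) × ℕ =>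
        (a.1.1.1.1.1, a.1.1.1.2, K * (a.1.1.1.2 + 1) * (k + 1)) :=
      (Primrec.fst.comp (Primrec.fst.comp (Primrec.fst.comp (Primrec.fst.comp Primrec.fst)))).pair
        ((Primrec.snd.comp (Primrec.fst.comp (Primrec.fst.comp Primrec.fst))).pair
          (hcells.comp (Primrec.snd.comp (Primrec.fst.comp (Primrec.fst.comp Primrec.fst)))))
    have ht : Primrec fun a : ((((ℕ × ℕ) × ℕ) × ℕ) × ℕ) × ℕ => a.1.1.1.1.2 :=
      Primrec.snd.comp (Primrec.fst.comp (Primrec.fst.comp (Primrec.fst.comp Primrec.fst)))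
    have hq : Primrec fun a : ((((ℕ × ℕ) × ℕ) × ℕ) × ℕ) × ℕ => a.1.1.2 :=
      Primrec.snd.comp (Primrec.fst.comp Primrec.fst)
    have hb : Primrec fun a : ((((ℕ × ℕ) × ℕ) × ℕ) × ℕ) × ℕ => a.1.2 * (k + 1) :=
      Primrec.nat_mul.comp (Primrec.snd.comp Primrec.fst) (Primrec.const (k + 1))
    have hbj : Primrec fun a : ((((ℕ × ℕ) × ℕ) × ℕ) × ℕ) × ℕ => a.1.2 * (k + 1) + a.2 + 1 :=
      Primrec.succ.comp (Primrec.nat_add.comp hb Primrec.snd)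
    have h1 := primrec_translateColor.comp (hctx.pair (ht.pair (hq.pair hb)))
    have h2 := primrec_translateColor.comp (hctx.pair (ht.pair (hq.pair hbj)))
    exact PrimrecPred.forall_lt_of (Primrec.const k) (PrimrecPred.not (Primrec.eq.comp h1 h2))
  exact PrimrecPred.forall_lt_of Primrec.fst (hdistinct.imp
    (PrimrecPred.forall_lt_of (primrec_two_pow.comp (Primrec.succ.comp
      (Primrec.fst.comp Primrec.fst)))
      (PrimrecPred.exists_lt_of (hblocks.comp (Primrec.snd.comp Primrec.fst)) hblock)))

theorem approx_lt_two_pow_approxWidth {s e n i : ℕ} (h : i < n) :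
    approx s e i < 2 ^ approxWidth s e n :=
  lt_of_le_of_lt (Finset.single_le_sum (f := approx s e) (fun _ _ => Nat.zero_le _)
    (Finset.mem_range.2 h)) Nat.lt_two_pow_self

theorem exists_tableColor_eq (f : Finset ℕ) : ∃ t, ∀ x, tableColor t x = decide (x ∈ f) := by
  refine ⟨Encodable.encode ((List.range (f.sup id + 1)).map fun x => decide (x ∈ f)), fun x => ?_⟩
  rw [tableColor, Encodable.encodek, Option.getD_some]
  by_cases hx : x < f.sup id + 1
  · simp [List.getD, hx]
  · have : x ∉ f := fun h => hx (Nat.lt_succ_of_le (Finset.le_sup (f := id) h))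
    simp [List.getD, hx, this]

theorem exists_isGoodTable (k : ℕ) : ∃ K, ∀ s, ∃ t, IsGoodTable K k s t := by
  obtain ⟨K, H⟩ := exists_blockFactor k
  refine ⟨K, fun s => ?_⟩
  classical
  set n : ℕ → ℕ := fun e => K * (e + 1) * (k + 1) with hn
  set I : Finset (ℕ × ℕ) := (Finset.range s ×ˢ Finset.range (2 ^ (s + 1))).filter fun i =>
    ∀ m < n i.1, ∀ m' < m, approx s i.1 m ≠ approx s i.1 m' with hI
  have hlt : ∀ {e m}, m < n e → approx s e m < 2 ^ approxWidth s e (n e) :=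
    fun h => approx_lt_two_pow_approxWidth h
  obtain ⟨f, hf⟩ := H I Prod.fst (fun i m => 2 ^ approxWidth s i.1 (n i.1) * i.2 + approx s i.1 m)
    (fun i hi m hm m' hm' h => by
      have hdist := (Finset.mem_filter.1 hi).2
      have h : approx s i.1 m = approx s i.1 m' := Nat.add_left_cancel h
      rcases lt_trichotomy m m' with hlt' | heq | hlt'
      · exact absurd h.symm (hdist m' hm' m hlt')
      · exact heq
      · exact absurd h (hdist m hm m' hlt'))
    (fun i _ i' _ htyp m hm m' hm' h => by
      obtain ⟨e, q⟩ := i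
      obtain ⟨e', q'⟩ := i'
      obtain rfl : e = e' := htyp
      have h' := congrArg (· / 2 ^ approxWidth s e (n e)) h
      simp only [Nat.mul_add_div (Nat.two_pow_pos _), Nat.div_eq_of_lt (hlt hm),
        Nat.div_eq_of_lt (hlt hm'), add_zero] at h'
      rw [h'])
  obtain ⟨t, ht⟩ := exists_tableColor_eq f
  refine ⟨t, fun e he hdist q hq => ?_⟩
  obtain ⟨b, hb, h⟩ := hf (e, q) (Finset.mem_filter.2 ⟨Finset.mem_product.2
    ⟨Finset.mem_range.2 he, Finset.mem_range.2 hq⟩, hdist⟩)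
  refine ⟨b, hb, fun j hj => ?_⟩
  rw [translateColor, translateColor, ht, ht]
  exact fun heq => h j hj (decide_eq_decide.1 heq)

theorem exists_computable_isGoodTable (k : ℕ) :
    ∃ (K : ℕ) (T : ℕ → ℕ), Computable T ∧ ∀ s, IsGoodTable K k s (T s) := by
  obtain ⟨K, hex⟩ := exists_isGoodTable k
  classical
  exact ⟨K, fun s => Nat.find (hex s), Computable.find (primrecPred_isGoodTable K k).computablePred
    hex, fun s => Nat.find_spec (hex s)⟩

/-! ### The coloring of finite sets -/

theorem computable_log_two : Computable (Nat.log 2) := by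
  have hex : ∀ x : ℕ, ∃ s, x < 2 ^ (s + 1) := fun x => ⟨_, Nat.lt_pow_succ_log_self one_lt_two x⟩
  refine (Computable.find (P := fun x s => x < 2 ^ (s + 1)) (PrimrecPred.computablePred
    (Primrec.nat_lt.comp Primrec.fst (primrec_two_pow.comp (Primrec.succ.comp Primrec.snd))))
      hex).of_eq fun x => (Nat.find_eq_iff _).2
        ⟨Nat.lt_pow_succ_log_self one_lt_two x, fun s hs => ?_⟩
  have hx : x ≠ 0 := by
    rintro rfl
    simp at hs
  exact not_lt.2 (Nat.pow_le_of_le_log hx hs)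

/-- The coloring of a finite set by the entry at its binary code `x` of the table for the stage
`Nat.log 2 x`, which is the largest element of the set if there is one. -/
def stageColoring (T : ℕ → ℕ) (F : Finset ℕ) : Fin 2 :=
  bif tableColor (T (Nat.log 2 (binaryCode F))) (binaryCode F) then 1 else 0

theorem computable_stageColoring {T : ℕ → ℕ} (hT : Computable T) :
    Computable (stageColoring T) :=
  Computable.cond (primrec_tableColor.to_comp.comp
    (hT.comp (computable_log_two.comp primrec_binaryCode.to_comp)) primrec_binaryCode.to_comp)
    (Computable.const 1) (Computable.const 0)

theorem GeneratesIP.infinite_setOf_forall_le {𝒮 : Set (Finset ℕ)} (h : GeneratesIP 𝒮) (N : ℕ) :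
    {B | B ∈ 𝒮 ∧ ∀ x ∈ B, N ≤ x}.Infinite := by
  obtain ⟨𝒟, hsub, hinf, hdisj⟩ := h
  have hfin : (⋃ x ∈ Finset.range N, {B | B ∈ 𝒟 ∧ x ∈ B}).Finite := by
    refine (Finset.range N).finite_toSet.biUnion fun x _ => Set.Subsingleton.finite ?_
    rintro B ⟨hB, hxB⟩ B' ⟨hB', hxB'⟩
    by_contra hne
    exact Finset.disjoint_left.1 (hdisj hB hB' hne) hxB hxB'
  refine (hinf.sdiff hfin).mono fun B hB => ⟨hsub hB.1, fun x hx => ?_⟩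
  by_contra! hlt
  exact hB.2 (Set.mem_biUnion (Finset.mem_coe.2 (Finset.mem_range.2 hlt)) ⟨hB.1, hx⟩)

/-- A c.e. family stays c.e. when restricted to the sets above a bound. -/
theorem IsCE.rePred_and_forall_le {𝒮 : Set (Finset ℕ)} (h : IsCE 𝒮) (N : ℕ) :
    REPred fun B : Finset ℕ => B ∈ 𝒮 ∧ ∀ x ∈ B, N ≤ x := by
  have hdvd : PrimrecPred fun B : Finset ℕ => binaryCode B % 2 ^ N = 0 :=
    Primrec.eq.comp (Primrec.nat_mod.comp primrec_binaryCode (Primrec.const (2 ^ N)))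
      (Primrec.const 0)
  have hre : REPred fun B : Finset ℕ => binaryCode B % 2 ^ N = 0 := hdvd.computablePred.to_re
  have hbind : Partrec fun B : Finset ℕ =>
      (Part.assert (B ∈ 𝒮) fun _ => Part.some ()).bind fun _ =>
        Part.assert (binaryCode B % 2 ^ N = 0) fun _ => Part.some () :=
    Partrec.bind h (hre.comp Computable.fst).to₂
  refine hbind.dom_re.of_eq fun B => ?_
  rw [← two_pow_dvd_binaryCode_iff, Nat.dvd_iff_mod_eq_zero]
  simp [Part.assert]

/-- The concatenation of the blocks of codes of `h i ∪ l₀, …, h i ∪ l_k`, for `i = 0, 1, …`. The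
codes are written as sums, which is right if `h i` is disjoint from the entries of `l`. -/
def blockSequence (h : ℕ → Finset ℕ) (l : List (Finset ℕ)) (m : ℕ) : ℕ :=
  binaryCode (h (m / l.length)) + binaryCode (l.getD (m % l.length) ∅)

theorem computable_blockSequence {h : ℕ → Finset ℕ} (hh : Computable h) (l : List (Finset ℕ)) :
    Computable (blockSequence h l) := by
  have h1 : Primrec fun m : ℕ => m / l.length := Primrec.nat_div.comp Primrec.id (Primrec.const _)
  have h2 : Primrec fun m : ℕ => m % l.length := Primrec.nat_mod.comp Primrec.id (Primrec.const _)
  exact Primrec.nat_add.to_comp.comp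
    (primrec_binaryCode.to_comp.comp (hh.comp h1.to_comp))
    (primrec_binaryCode.comp ((Primrec.list_getD ∅).comp (Primrec.const l) h2)).to_comp

theorem blockSequence_injective {h : ℕ → Finset ℕ} {l : List (Finset ℕ)} {N : ℕ}
    (hinj : Function.Injective h) (hN : ∀ i, ∀ x ∈ h i, N ≤ x) (hl : ∀ F ∈ l, ∀ x ∈ F, x < N)
    (hnodup : l.Nodup) (hpos : 0 < l.length) : Function.Injective (blockSequence h l) := by
  have hlow : ∀ m, binaryCode (l.getD (m % l.length) ∅) < 2 ^ N := fun m => by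
    rw [List.getD_eq_getElem _ _ (Nat.mod_lt m hpos)]
    exact binaryCode_lt_two_pow (hl _ (List.getElem_mem _))
  -- The two summands are the digits below and above `N`.
  have hmod : ∀ m, blockSequence h l m % 2 ^ N = binaryCode (l.getD (m % l.length) ∅) := fun m => by
    obtain ⟨q, hq⟩ := two_pow_dvd_binaryCode_iff.2 (hN (m / l.length))
    rw [blockSequence, hq, Nat.mul_add_mod, Nat.mod_eq_of_lt (hlow m)]
  intro m m' hmm
  have hlcode : binaryCode (l.getD (m % l.length) ∅) = binaryCode (l.getD (m' % l.length) ∅) := by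
    rw [← hmod, ← hmod, hmm]
  have hhcode : binaryCode (h (m / l.length)) = binaryCode (h (m' / l.length)) := by
    unfold blockSequence at hmm
    omega
  have hdiv := hinj (binaryCode_injective hhcode)
  have hmod' : m % l.length = m' % l.length := by
    have := binaryCode_injective hlcode
    rw [List.getD_eq_getElem _ _ (Nat.mod_lt m hpos),
      List.getD_eq_getElem _ _ (Nat.mod_lt m' hpos)] at this
    exact (hnodup.getElem_inj_iff).1 this
  rw [← Nat.div_add_mod m l.length, ← Nat.div_add_mod m' l.length, hdiv, hmod']

/-- A total computable function is the limit of its stage approximations, and any finite part of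
it is eventually attained. -/
theorem exists_forall_approx_eq {g : ℕ → ℕ} (hg : Computable g) :
    ∃ e, ∀ n, ∃ s₀, ∀ s ≥ s₀, ∀ m < n, approx s e m = g m := by
  obtain ⟨c, hc⟩ := Nat.Partrec.Code.exists_code.1 (Partrec.nat_iff.1 hg)
  have hev : ∀ m, ∃ t, g m ∈ Nat.Partrec.Code.evaln t c m := fun m =>
    Nat.Partrec.Code.evaln_complete.1 (by rw [hc]; simp)
  choose t ht using hev
  refine ⟨Encodable.encode c, fun n => ⟨(Finset.range n).sup t, fun s hs m hm => ?_⟩⟩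
  have := Nat.Partrec.Code.evaln_mono
    ((Finset.le_sup (f := t) (Finset.mem_range.2 hm)).trans hs) (ht m)
  rw [approx, Denumerable.ofNat_encode, Option.mem_def.1 this, Option.getD_some]

/-- Nonempty finite sets, at most `k` of them, are among the nonempty entries of a list without
repetitions of `k + 1` finite sets that starts with `∅`. -/
theorem exists_list_of_card_le {k : ℕ} {𝒜 : Finset (Finset ℕ)} (hcard : 𝒜.card ≤ k)
    (hempty : ∅ ∉ 𝒜) : ∃ l : List (Finset ℕ), l.Nodup ∧ l.length = k + 1 ∧ l.getD 0 ∅ = ∅ ∧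
      ∀ D ∈ 𝒜, ∃ j < k, l.getD (j + 1) ∅ = D := by
  obtain ⟨𝒜', hsub, hcard'⟩ := Infinite.exists_superset_card_eq (insert ∅ 𝒜) (k + 1)
    ((Finset.card_insert_le _ _).trans (by omega))
  have hmem : ∅ ∈ 𝒜' := hsub (Finset.mem_insert_self _ _)
  have hlen : (𝒜'.erase ∅).toList.length = k := by
    rw [Finset.length_toList, Finset.card_erase_of_mem hmem, hcard', Nat.add_sub_cancel]
  refine ⟨∅ :: (𝒜'.erase ∅).toList, ?_, by rw [List.length_cons, hlen], rfl, fun D hD => ?_⟩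
  · exact List.nodup_cons.2 ⟨by simp, Finset.nodup_toList _⟩
  · have hD' : D ∈ (𝒜'.erase ∅).toList := Finset.mem_toList.2 (Finset.mem_erase.2
      ⟨fun h => hempty (h ▸ hD), hsub (Finset.mem_insert_of_mem hD)⟩)
    obtain ⟨j, hj, rfl⟩ := List.getElem_of_mem hD'
    exact ⟨j, hlen ▸ hj, by rw [List.getD_cons_succ, List.getD_eq_getElem _ _ hj]⟩

/-- The heart of the matter: with `h b` running through elements of `𝒮` above `𝒜`, the codes of
`h b` and its unions with the elements of `𝒜` form the blocks of one program. A good table for the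
stage of a remote `C ∈ 𝒮` separates some `h b ∪ C` from all `D ∪ (h b ∪ C)`, as adding `C`
translates the blocks by the code of `C`. -/
theorem exists_forall_stageColoring_ne {K k : ℕ} {T : ℕ → ℕ}
    (hT : ∀ s, IsGoodTable K k s (T s)) {𝒜 : Finset (Finset ℕ)} (hcard : 𝒜.card ≤ k)
    (hempty : ∅ ∉ 𝒜) {𝒮 : Set (Finset ℕ)} (hce : IsCE 𝒮) (hip : GeneratesIP 𝒮) :
    ∃ B ∈ nonemptyUnions 𝒮, ∀ D ∈ 𝒜, stageColoring T B ≠ stageColoring T (D ∪ B) := by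
  obtain ⟨l, hnodup, hlen, hl0, hlmem⟩ := exists_list_of_card_le hcard hempty
  obtain ⟨N, hN⟩ : ∃ N, ∀ F ∈ l, ∀ x ∈ F, x < N := by
    refine ⟨(l.toFinset.sup id).sup id + 1, fun F hF x hx => Nat.lt_succ_of_le ?_⟩
    exact Finset.le_sup (f := id) (Finset.le_sup (f := id) (List.mem_toFinset.2 hF) hx)
  obtain ⟨h, hcomp, hmem, hmono⟩ := (hce.rePred_and_forall_le N).exists_computable_strictMono
    (hip.infinite_setOf_forall_le N) primrec_binaryCode.to_comp binaryCode_injective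
  have hinj : Function.Injective h := hmono.injective.of_comp
  have hginj := blockSequence_injective hinj (fun i => (hmem i).2) hN hnodup (by omega)
  obtain ⟨e, he⟩ := exists_forall_approx_eq (computable_blockSequence hcomp l)
  set g := blockSequence h l with hg
  set n := K * (e + 1) * (k + 1) with hn
  obtain ⟨s₀, hs₀⟩ := he n
  set w := ∑ m ∈ Finset.range n, g m with hw
  have hgw : ∀ m < n, g m < 2 ^ w := fun m hm => lt_of_le_of_lt
    (Finset.single_le_sum (f := g) (fun _ _ => Nat.zero_le _) (Finset.mem_range.2 hm))
      Nat.lt_two_pow_self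
  -- Beyond `w` the code of `C` is a multiple of `2 ^ w`; beyond `s₀` and `e`, its stage knows the
  -- first `n` values of the program `e` and takes that program into account.
  obtain ⟨C, ⟨hC𝒮, hCle⟩, hCne⟩ :=
    ((hip.infinite_setOf_forall_le (w + s₀ + e + 1)).sdiff (Set.finite_singleton ∅)).nonempty
  have hCne : C.Nonempty := Finset.nonempty_iff_ne_empty.2 hCne
  set s := Nat.log 2 (binaryCode C) with hs
  have hCpos : binaryCode C ≠ 0 := by
    obtain ⟨x, hx⟩ := hCne
    have := Finset.single_le_sum (f := fun i => 2 ^ i) (fun _ _ => Nat.zero_le _) hx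
    have h2 : 0 < 2 ^ x := by positivity
    change 2 ^ x ≤ binaryCode C at this
    omega
  have hsle : w + s₀ + e + 1 ≤ s := Nat.le_log_of_pow_le one_lt_two
    (Nat.le_of_dvd (Nat.pos_of_ne_zero hCpos) (two_pow_dvd_binaryCode_iff.2 hCle))
  obtain ⟨q, hq⟩ := two_pow_dvd_binaryCode_iff.2 fun x hx =>
    (by omega : w ≤ w + s₀ + e + 1).trans (hCle x hx)
  have hCs : 2 ^ s ≤ binaryCode C := Nat.pow_log_le_self 2 hCpos
  have hCs' : binaryCode C < 2 ^ (s + 1) := Nat.lt_pow_succ_log_self one_lt_two _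
  have happrox : ∀ m < n, approx s e m = g m := hs₀ s (by omega)
  have hwidth : approxWidth s e n = w :=
    Finset.sum_congr rfl fun m hm => happrox m (Finset.mem_range.1 hm)
  have hqlt : q < 2 ^ (s + 1) :=
    lt_of_le_of_lt (hq ▸ Nat.le_mul_of_pos_left q (by positivity)) hCs'
  obtain ⟨b, hb, hblock⟩ := hT s e (by omega) (fun m hm m' hm' heq => by
    rw [happrox m hm, happrox m' (hm'.trans hm)] at heq
    exact hm'.ne' (hginj heq)) q hqlt
  simp only [translateColor, ← hn, hwidth, ← hq] at hblock
  have hbn : ∀ j < k + 1, b * (k + 1) + j < n := fun j hj => by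
    rw [hn]; nlinarith
  have hgb : ∀ j < k + 1,
      g (b * (k + 1) + j) = binaryCode (h b) + binaryCode (l.getD j ∅) := fun j hj => by
    rw [hg, blockSequence, hlen, mul_comm b, Nat.mul_add_div (by omega), Nat.div_eq_of_lt hj,
      Nat.mul_add_mod, Nat.mod_eq_of_lt hj, add_zero]
  have hbw : ∀ x ∈ h b, x < w := fun x hx => by
    have h1 := hgw _ (hbn 0 (by omega))
    rw [hgb 0 (by omega)] at h1
    exact lt_of_binaryCode_lt (by omega) hx
  have hdisj : Disjoint (h b) C := Finset.disjoint_left.2 fun x hx hxC => by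
    have := hbw x hx
    have := hCle x hxC
    omega
  have hcode : ∀ j < k + 1,
      binaryCode (l.getD j ∅ ∪ (h b ∪ C)) = binaryCode C + g (b * (k + 1) + j) := fun j hj => by
    have hd : Disjoint (l.getD j ∅) (h b ∪ C) := Finset.disjoint_left.2 fun x hx hxC => by
      rw [List.getD_eq_getElem _ _ (by omega)] at hx
      have h1 := hN _ (List.getElem_mem _) x hx
      have h2 : x < w := by
        have h3 := hgw _ (hbn j hj)
        rw [hgb j hj, List.getD_eq_getElem _ _ (by omega)] at h3
        exact lt_of_binaryCode_lt (by omega) hx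
      rcases Finset.mem_union.1 hxC with h3 | h3
      · have := (hmem b).2 x h3
        omega
      · have := hCle x h3
        omega
    rw [binaryCode_union hd, binaryCode_union hdisj, hgb j hj]
    ring
  have hlog : ∀ r < 2 ^ w, Nat.log 2 (binaryCode C + r) = s := fun r hr => by
    refine Nat.log_eq_of_pow_le_of_lt_pow (hCs.trans (Nat.le_add_right _ _)) ?_
    have hpow : 2 ^ (s + 1) = 2 ^ w * 2 ^ (s + 1 - w) := by
      rw [← pow_add]; congr 1; omega
    rw [hq, hpow] at hCs' ⊢
    have hq' : q + 1 ≤ 2 ^ (s + 1 - w) := Nat.lt_of_mul_lt_mul_left hCs'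
    calc 2 ^ w * q + r < 2 ^ w * (q + 1) := by rw [mul_add, mul_one]; omega
      _ ≤ _ := Nat.mul_le_mul_left _ hq'
  have hcolor : ∀ j < k + 1, stageColoring T (l.getD j ∅ ∪ (h b ∪ C)) =
      bif tableColor (T s) (binaryCode C + g (b * (k + 1) + j)) then 1 else 0 := fun j hj => by
    rw [stageColoring, hcode j hj, hlog _ (hgw _ (hbn j hj))]
  refine ⟨h b ∪ C, ⟨hCne.mono Finset.subset_union_right, {h b, C}, ?_, ?_⟩, fun D hD heq => ?_⟩
  · intro B hB
    rcases Finset.mem_insert.1 hB with rfl | hB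
    · exact (hmem b).1
    · exact Finset.mem_singleton.1 hB ▸ hC𝒮
  · simp
  · obtain ⟨j, hj, rfl⟩ := hlmem D hD
    have h0 := hcolor 0 (by omega)
    rw [hl0, Finset.empty_union] at h0
    rw [h0, hcolor (j + 1) (by omega)] at heq
    refine hblock j hj ?_
    have happ0 := happrox _ (hbn 0 (by omega))
    rw [add_zero] at happ0 heq
    have happ1 := happrox _ (hbn (j + 1) (by omega))
    rw [← add_assoc] at happ1 heq
    rw [happ0, happ1]
    revert heq
    cases tableColor (T s) (binaryCode C + g (b * (k + 1))) <;>
      cases tableColor (T s) (binaryCode C + g (b * (k + 1) + j + 1)) <;> simp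

theorem IsIP.nonemptyUnions_subset {𝒯 : Set (Finset ℕ)} (h : IsIP 𝒯) : nonemptyUnions 𝒯 ⊆ 𝒯 := by
  rintro _ ⟨hne, F, hF, rfl⟩
  have hFne : F.Nonempty := by
    by_contra hF0
    rw [Finset.not_nonempty_iff_eq_empty.1 hF0] at hne
    simp at hne
  rw [← Finset.sup'_eq_sup hFne]
  exact Finset.sup'_induction hFne id (fun S hS T hT => h.1 S hS T hT) hF

theorem mainTheorem6 (k : ℕ) :
    ∃ c : Finset ℕ → Fin 2, Computable c ∧
      (∀ 𝒜 : Finset (Finset ℕ), 𝒜.card ≤ k → ∅ ∉ 𝒜 →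
        ∀ 𝒮 : Set (Finset ℕ), IsCE 𝒮 → GeneratesIP 𝒮 →
          ¬ HalfMatches c (𝒜 : Set (Finset ℕ)) (nonemptyUnions 𝒮)) ∧
      (∀ 𝒮 : Set (Finset ℕ), IsIP 𝒮 → ∅ ∉ 𝒮 →
        ∀ ℬ : Finset (Finset ℕ), (ℬ : Set (Finset ℕ)) ⊆ 𝒮 → ℬ.card ≤ k →
          ¬ ∃ 𝒯 : Set (Finset ℕ), IsCE 𝒯 ∧ IsIP 𝒯 ∧
            𝒯 ⊆ strongDiff 𝒮 (ℬ : Set (Finset ℕ)) ∧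
            HalfMatches c (ℬ : Set (Finset ℕ)) 𝒯) := by
  obtain ⟨K, T, hTcomp, hT⟩ := exists_computable_isGoodTable k
  have hmain : ∀ 𝒜 : Finset (Finset ℕ), 𝒜.card ≤ k → ∅ ∉ 𝒜 →
      ∀ 𝒮 : Set (Finset ℕ), IsCE 𝒮 → GeneratesIP 𝒮 →
        ¬ HalfMatches (stageColoring T) (𝒜 : Set (Finset ℕ)) (nonemptyUnions 𝒮) := by
    intro 𝒜 hcard hempty 𝒮 hce hip hhalf
    obtain ⟨B, hB, hne⟩ := exists_forall_stageColoring_ne hT hcard hempty hce hip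
    obtain ⟨D, hD, heq⟩ := hhalf B hB
    exact hne D hD heq
  refine ⟨stageColoring T, computable_stageColoring hTcomp, hmain, ?_⟩
  rintro 𝒮 - hempty ℬ hℬ hcard ⟨𝒯, hce, hip, -, hhalf⟩
  exact hmain ℬ hcard (fun h => hempty (hℬ h)) 𝒯 hce hip.2
    fun B hB => hhalf B (hip.nonemptyUnions_subset hB)
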